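/- Let $I\subseteq\mathbb R$ be an open interval containing $0$, let $g:I\to\mathbb R$ be real analytic with $g(0)=0$ and $g'(0)=1$, and let $G(x)=\int_0^x g(\xi)\,d\xi$ be the potential of the equation $\ddot x+g(x)=0$. Suppose that hypothesis $(\mathcal H)$ holds: there are $a<0<b$ in $I$ and $c\in\mathbb R$ such that $G(a)=G(b)=c$, and $G(x)<c$ and $x\,g(x)>0$ for all $x\neq 0$ with $a<x<b$. Suppose further that on $I$ the potential $G$ is a rational function (without poles in $I$) and is not a polynomial. Call $G$ isochronous if all orbits other than the origin of the system $\dot x=y,\ \dot y=-g(x)$ in a sufficiently small neighbourhood of the origin of $\mathbb R^2$ are periodic with one and the same minimal period. Then $G$ is isochronous if and only if it is an isotonic potential, that is, if and only if there is a real $\alpha\neq 0$ such that, for all $x\in I$, $\alpha x+1\neq 0$ and $$G(x)=\frac{1}{8\alpha^2}\Big[\alpha x+1-\frac{1}{\alpha x+1}\Big]^2 .$$ -/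

import Mathlib

/-- The potential `G(x) = ∫₀ˣ g(ξ) dξ` of the equation `x'' + g(x) = 0`. -/
noncomputable def potential (g : ℝ → ℝ) (x : ℝ) : ℝ := ∫ ξ in (0 : ℝ)..x, g ξ

/-- Hypothesis `(H)` for `g` on `I`: there are `a < 0 < b` with `G(a) = G(b) = c`, and
`G(x) < c`, `x g(x) > 0` for all `x ≠ 0` with `a < x < b`. -/
def HypothesisH (I : Set ℝ) (g : ℝ → ℝ) : Prop :=
  ∃ a ∈ I, ∃ b ∈ I, ∃ c : ℝ, a < 0 ∧ 0 < b ∧ potential g a = c ∧ potential g b = c ∧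
    ∀ x ∈ Set.Ioo a b, x ≠ 0 → potential g x < c ∧ 0 < x * g x

/-- `γ = (x, y)` is a solution, defined for all times and with `x(t) ∈ I`, of the planar system
`x' = y`, `y' = -g(x)`. -/
def IsSolution (I : Set ℝ) (g : ℝ → ℝ) (γ : ℝ → ℝ × ℝ) : Prop :=
  ∀ t : ℝ, (γ t).1 ∈ I ∧ HasDerivAt γ ((γ t).2, -g (γ t).1) t

/-- `T` is the minimal period of `γ`. -/
def IsMinimalPeriod (γ : ℝ → ℝ × ℝ) (T : ℝ) : Prop :=
  IsLeast {S : ℝ | 0 < S ∧ Function.Periodic γ S} T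

/-- The origin is an isochronous center of `x' = y`, `y' = -g(x)` (the potential of `g` is
isochronous): all orbits near the origin, other than the origin itself, are periodic with one and
the same minimal period. -/
def IsIsochronous (I : Set ℝ) (g : ℝ → ℝ) : Prop :=
  ∃ T : ℝ, ∃ U ∈ nhds (0 : ℝ × ℝ), ∀ p ∈ U, p ≠ 0 →
    ∃ γ : ℝ → ℝ × ℝ, IsSolution I g γ ∧ γ 0 = p ∧ IsMinimalPeriod γ T

/-- `G` is given on `I` by a rational function without poles in `I`. -/
def IsRationalOn (G : ℝ → ℝ) (I : Set ℝ) : Prop :=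
  ∃ P Q : Polynomial ℝ, ∀ x ∈ I, Q.eval x ≠ 0 ∧ G x = P.eval x / Q.eval x

/-- `G` is given on `I` by a polynomial. -/
def IsPolynomialOn (G : ℝ → ℝ) (I : Set ℝ) : Prop :=
  ∃ P : Polynomial ℝ, ∀ x ∈ I, G x = P.eval x

/-! Near `0` take an analytic coordinate `x = X(s)` with `G(X(s)) = s²/2`; the orbit of radius `r`
is `x = X(r sin θ)`, `y = r cos θ`, with period `∫₀^{2π} X'(r sin θ) dθ`
(`IsMinimalPeriod.eq_integral`). A constant period determines the even part of `X'` (Abel), whence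
`X(s) - X(-s) = 2s` (`IsIsochronous.sub_eq_two_mul`).

Now let `G = P/Q`. Since `G(x - 2s) = G(x)` while `s² = 2G(x)`, eliminating powers of `s` gives a
relation linear in `s`, so `s`, and with it the involution `σ : X(s) ↦ X(-s)`, is rational in `x`
(`Polynomial.exists_rational_reflection`). A rational involution fixing `0` is Möbius, here `σ(x) =
-x/(1 + βx)`. Then `s = (x - σ(x))/2` gives `G = s²/2` explicitly: harmonic for `β = 0`, isotonic
otherwise.

Conversely, for an isotonic potential `(αx + 1)²` oscillates harmonically with frequency `1`
(`IsIsochronous.of_isotonic`). -/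

open Filter Topology

/-! ### Polynomial algebra: elimination of `s`, and rational involutions -/

open Polynomial in
/-- Modulo the relation `s² Q(x) = 2 P(x)`, every polynomial in `x + 2 s` becomes linear in `s`. -/
theorem Polynomial.exists_linear_of_sq_relation (P Q f : ℝ[X]) :
    ∃ A B : ℝ[X], ∃ N : ℕ, ∀ x s : ℝ, s ^ 2 * Q.eval x = 2 * P.eval x →
      Q.eval x ^ N * f.eval (x + 2 * s) = A.eval x + s * B.eval x := by
  induction f using Polynomial.induction_on with
  | C a => exact ⟨C a, 0, 0, fun x s _ => by simp⟩
  | add p q hp hq =>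
    obtain ⟨A, B, N, h⟩ := hp
    obtain ⟨A', B', N', h'⟩ := hq
    refine ⟨Q ^ N' * A + Q ^ N * A', Q ^ N' * B + Q ^ N * B', N + N', fun x s hs => ?_⟩
    have h1 := h x s hs
    have h2 := h' x s hs
    simp only [eval_add, eval_mul, eval_pow]
    linear_combination Q.eval x ^ N' * h1 + Q.eval x ^ N * h2
  | monomial n a h =>
    obtain ⟨A, B, N, h⟩ := h
    -- In `Q (x + 2s)(A + sB)` the term `2s²QB` becomes `4PB`; each such reduction costs one factor
    -- `Q`.
    refine ⟨Q * X * A + 4 * P * B, 2 * Q * A + Q * X * B, N + 1, fun x s hs => ?_⟩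
    have h1 := h x s hs
    simp only [eval_add, eval_mul, eval_pow, eval_C, eval_X, eval_ofNat] at h1 ⊢
    linear_combination Q.eval x * (x + 2 * s) * h1 + 2 * B.eval x * hs

open Polynomial in
/-- The homogenization of `f` in degree `n`, evaluated at a pair of polynomials `(c, b)`. -/
noncomputable def Polynomial.homogenizedAt (f : ℝ[X]) (n : ℕ) (b c : ℝ[X]) : ℝ[X] :=
  ∑ i ∈ Finset.range (n + 1), C (f.coeff i) * (c ^ i * b ^ (n - i))

-- Denominators are cleared in `f(c/b)`; the relation `b y = c` replaces `y = c/b`, so zeros of `b`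
-- need no exclusion.
open Polynomial in
theorem Polynomial.eval_homogenizedAt {f : ℝ[X]} {n : ℕ} (hf : f.natDegree ≤ n) {b c : ℝ[X]}
    {x y : ℝ} (h : b.eval x * y = c.eval x) :
    (f.homogenizedAt n b c).eval x = b.eval x ^ n * f.eval y := by
  rw [homogenizedAt, eval_finsetSum, eval_eq_sum_range' (Nat.lt_succ_of_le hf) y, Finset.mul_sum]
  refine Finset.sum_congr rfl fun i hi => ?_
  have hi' : i ≤ n := Nat.lt_succ_iff.mp (Finset.mem_range.mp hi)
  obtain ⟨k, rfl⟩ := Nat.exists_eq_add_of_le hi'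
  simp only [eval_mul, eval_C, eval_pow, ← h, Nat.add_sub_cancel_left]
  ring

-- Only the term of index `n` lacks a factor `b`; this and its companion for `c` allow the
-- involution identity to be read modulo `b` and modulo `c`.
open Polynomial in
theorem Polynomial.dvd_homogenizedAt_sub_top (f : ℝ[X]) (n : ℕ) (b c : ℝ[X]) :
    b ∣ f.homogenizedAt n b c - C (f.coeff n) * c ^ n := by
  rw [homogenizedAt, Finset.sum_range_succ]
  simp only [Nat.sub_self, pow_zero, mul_one, add_sub_cancel_right]
  refine Finset.dvd_sum fun i hi => ?_
  exact ((dvd_pow_self b (Nat.sub_ne_zero_of_lt (Finset.mem_range.mp hi))).mul_left _).mul_left _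

open Polynomial in
theorem Polynomial.dvd_homogenizedAt_sub_bot (f : ℝ[X]) (n : ℕ) (b c : ℝ[X]) :
    c ∣ f.homogenizedAt n b c - C (f.coeff 0) * b ^ n := by
  rw [homogenizedAt, Finset.sum_range_succ']
  simp only [Nat.sub_zero, pow_zero, one_mul, add_sub_cancel_right]
  refine Finset.dvd_sum fun i _ => ?_
  exact ((dvd_pow_self c (Nat.succ_ne_zero i)).mul_right _).mul_left _

open Polynomial in
/-- A rational function `c / b` that fixes `0` and is an involution is a Möbius transformation. -/
theorem Polynomial.exists_moebius_of_involution {b c : ℝ[X]} (hbc : IsCoprime b c)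
    (hc0 : c.eval 0 = 0) {S : Set ℝ} (hS : S.Infinite)
    (h : ∀ x ∈ S, ∃ y, b.eval x * y = c.eval x ∧ b.eval y * x = c.eval y) :
    ∃ k b₀ b₁ : ℝ, b₀ ≠ 0 ∧ c = C k * X ∧ b = C b₀ + C b₁ * X := by
  set n := max b.natDegree c.natDegree with hn
  have hb0 : b.coeff 0 ≠ 0 := by
    intro h0
    obtain ⟨u, v, huv⟩ := hbc
    have := congrArg (eval 0) huv
    rw [coeff_zero_eq_eval_zero] at h0
    simp [hc0, h0] at this
  -- The identity `σ(σ(x)) = x` for `σ = c/b`, cleared of denominators.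
  have hid : X * b.homogenizedAt n b c = c.homogenizedAt n b c := by
    refine eq_of_infinite_eval_eq _ _ (hS.mono fun x hx => ?_)
    obtain ⟨y, h1, h2⟩ := h x hx
    change (X * b.homogenizedAt n b c).eval x = (c.homogenizedAt n b c).eval x
    rw [eval_mul, eval_X, eval_homogenizedAt (le_max_left _ _) h1,
      eval_homogenizedAt (le_max_right _ _) h1, ← h2]
    ring
  -- Modulo `c` the identity reads `b(0) X bⁿ ≡ 0`, and `b` is invertible modulo `c`.
  have hcX : c ∣ X := by
    have h1 := (dvd_homogenizedAt_sub_bot b n b c).mul_left X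
    have h2 := dvd_homogenizedAt_sub_bot c n b c
    rw [coeff_zero_eq_eval_zero c, hc0, ← hid] at h2
    have h3 := dvd_sub h2 h1
    have h4 : c ∣ b ^ n * (C (b.coeff 0) * X) := by
      convert h3 using 1
      simp only [map_zero]
      ring
    have h5 := (hbc.symm.pow_right (n := n)).dvd_of_dvd_mul_left h4
    exact (IsUnit.dvd_mul_left (isUnit_C.mpr (isUnit_iff_ne_zero.mpr hb0))).mp h5
  have hbX : b ∣ C (c.coeff n) - X * C (b.coeff n) := by
    have h1 := (dvd_homogenizedAt_sub_top b n b c).mul_left X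
    have h2 := dvd_homogenizedAt_sub_top c n b c
    rw [← hid] at h2
    have h3 := dvd_sub h1 h2
    have h4 : b ∣ c ^ n * (C (c.coeff n) - X * C (b.coeff n)) := by
      convert h3 using 1
      ring
    exact (hbc.pow_right (n := n)).dvd_of_dvd_mul_left h4
  have hcdeg : c.natDegree ≤ 1 := (natDegree_le_of_dvd hcX X_ne_zero).trans natDegree_X_le
  -- Since `n` is the larger degree, one of the two coefficients is a leading coefficient.
  have hne : C (c.coeff n) - X * C (b.coeff n) ≠ 0 := by
    intro h0
    have e0 : c.coeff n = 0 := by simpa using congrArg (fun p => coeff p 0) h0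
    have e1 : b.coeff n = 0 := by simpa [coeff_C] using congrArg (fun p => coeff p 1) h0
    have hb : b ≠ 0 := fun hb => hb0 (by simp [hb])
    have hc : c ≠ 0 := fun hc => X_ne_zero (zero_dvd_iff.mp (hc ▸ hcX))
    rcases max_choice b.natDegree c.natDegree with h' | h'
    · rw [hn, h'] at e1
      exact hb (leadingCoeff_eq_zero.mp e1)
    · rw [hn, h'] at e0
      exact hc (leadingCoeff_eq_zero.mp e0)
  have hbdeg : b.natDegree ≤ 1 := by
    refine (natDegree_le_of_dvd hbX hne).trans ?_
    compute_degree
  refine ⟨c.coeff 1, b.coeff 0, b.coeff 1, hb0, ?_, ?_⟩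
  · conv_lhs => rw [eq_X_add_C_of_natDegree_le_one hcdeg, coeff_zero_eq_eval_zero c, hc0]
    simp
  · conv_lhs => rw [eq_X_add_C_of_natDegree_le_one hbdeg]
    rw [add_comm]

/-! ### The analytic coordinate in which the potential is `s²/2` -/

theorem AnalyticAt.exists_eq_mul_of_eq_zero {f : ℝ → ℝ} (hf : AnalyticAt ℝ f 0) (h0 : f 0 = 0) :
    ∃ k : ℝ → ℝ, AnalyticAt ℝ k 0 ∧ k 0 = deriv f 0 ∧ ∀ x, f x = x * k x := by
  obtain ⟨p, hp⟩ := hf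
  refine ⟨dslope f 0, hp.has_fpower_series_dslope_fslope.analyticAt, dslope_same f 0, fun x => ?_⟩
  have := sub_smul_dslope f 0 x
  simpa [h0] using this.symm

/-- An analytic function with a nondegenerate minimum `0` at `0` is, in a suitable analytic
coordinate, half the square. -/
theorem AnalyticAt.exists_square_coordinate {G : ℝ → ℝ} (hG : AnalyticAt ℝ G 0) (h0 : G 0 = 0)
    (h1 : deriv G 0 = 0) (h2 : deriv (deriv G) 0 = 1) :
    ∃ X : ℝ → ℝ, AnalyticAt ℝ X 0 ∧ X 0 = 0 ∧ deriv X 0 = 1 ∧ ∀ᶠ s in 𝓝 0, G (X s) = s ^ 2 / 2 := by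
  obtain ⟨k, hk, hk0, hGk⟩ := hG.exists_eq_mul_of_eq_zero h0
  obtain ⟨m, hm, hm0, hkm⟩ := hk.exists_eq_mul_of_eq_zero (hk0.trans h1)
  have hm1 : 2 * m 0 = 1 := by
    have hdG : deriv G =ᶠ[𝓝 0] fun x => x * (2 * m x + x * deriv m x) := by
      filter_upwards [hm.eventually_analyticAt] with x hx
      have : HasDerivAt (fun x => x * (x * m x)) (1 * (x * m x) + x * (1 * m x + x * deriv m x)) x :=
        (hasDerivAt_id x).mul ((hasDerivAt_id x).mul hx.differentiableAt.hasDerivAt)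
      have hfun : G = fun x => x * (x * m x) := by
        funext y
        rw [hGk, hkm]
      rw [hfun, this.deriv]
      ring
    have hd : DifferentiableAt ℝ (fun x => 2 * m x + x * deriv m x) 0 :=
      (hm.differentiableAt.const_mul 2).add (differentiableAt_id.mul hm.deriv.differentiableAt)
    have := (hasDerivAt_id (0 : ℝ)).mul hd.hasDerivAt
    rw [hdG.deriv_eq, show deriv (fun x => x * (2 * m x + x * deriv m x)) 0 = _ from this.deriv]
      at h2
    simpa using h2
  have hne : 2 * m 0 ≠ 0 := by rw [hm1]; exact one_ne_zero
  -- With `G = x² m(x)`, the function `S(x) = x √(2m(x))` satisfies `S²/2 = G` wherever `m ≥ 0`; `X`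
  -- is its local inverse.
  have hsq : AnalyticAt ℝ (fun x => √(2 * m x)) 0 :=
    (((analyticAt_const.mul hm).contDiffAt (n := ⊤)).sqrt hne).analyticAt
  have hS : AnalyticAt ℝ (fun x => x * √(2 * m x)) 0 := analyticAt_id.mul hsq
  have hS1 : deriv (fun x => x * √(2 * m x)) 0 = 1 := by
    have := (hasDerivAt_id (0 : ℝ)).mul hsq.differentiableAt.hasDerivAt
    rw [show deriv (fun x => x * √(2 * m x)) 0 = _ from this.deriv]
    simp [hm1]
  have hS' : deriv (fun x => x * √(2 * m x)) 0 ≠ 0 := by rw [hS1]; exact one_ne_zero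
  have hXan := hS.analyticAt_localInverse hS'
  have hXd := (hS.hasStrictDerivAt.to_localInverse hS').hasDerivAt.deriv
  have hXr := hS.hasStrictDerivAt.eventually_right_inverse hS'
  have hX0 : hS.hasStrictDerivAt.localInverse _ _ _ hS' ((0 : ℝ) * √(2 * m 0)) = 0 :=
    HasStrictFDerivAt.localInverse_apply_image ..
  set X := hS.hasStrictDerivAt.localInverse _ _ _ hS' with hX
  simp only [zero_mul] at hXan hXd hXr hX0
  refine ⟨X, hXan, hX0, by rw [hXd, hS1, inv_one], ?_⟩
  have hpos : ∀ᶠ s in 𝓝 (0 : ℝ), 0 < m (X s) := by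
    have hc : ContinuousAt (fun s => m (X s)) 0 :=
      ContinuousAt.comp (by rw [hX0]; exact hm.continuousAt) hXan.continuousAt
    refine hc.eventually (lt_mem_nhds ?_)
    simp only [hX0]
    linarith
  filter_upwards [hXr, hpos] with s hs hp
  rw [hGk, hkm]
  have h3 : (X s * √(2 * m (X s))) ^ 2 = s ^ 2 := by rw [hs]
  rw [mul_pow, Real.sq_sqrt (by linarith)] at h3
  linarith

/-! ### The period of an orbit as an integral -/

theorem AnalyticOnNhd.exists_lipschitzOnWith_Icc {g : ℝ → ℝ} {c d : ℝ}
    (hg : AnalyticOnNhd ℝ g (Set.Icc c d)) :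
    ∃ K, LipschitzOnWith K g (Set.Icc c d) := by
  obtain ⟨C, hC⟩ := isCompact_Icc.exists_bound_of_continuousOn hg.deriv.continuousOn
  refine ⟨C.toNNReal, (convex_Icc c d).lipschitzOnWith_of_nnnorm_deriv_le
    (fun x hx => (hg x hx).differentiableAt) fun x hx => ?_⟩
  rw [← NNReal.coe_le_coe, coe_nnnorm]
  exact (hC x hx).trans (Real.le_coe_toNNReal C)

/-- Two compact subsets of an interval lie in a common compact subinterval. -/
theorem IsCompact.exists_Icc_of_ordConnected {I K L : Set ℝ} (hI : I.OrdConnected)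
    (hK : IsCompact K) (hL : IsCompact L) (hKn : K.Nonempty) (hKI : K ⊆ I) (hLI : L ⊆ I) :
    ∃ c d, Set.Icc c d ⊆ I ∧ K ⊆ Set.Icc c d ∧ L ⊆ Set.Icc c d := by
  have hKL := hK.union hL
  have hn : (K ∪ L).Nonempty := hKn.mono Set.subset_union_left
  have hsub : K ∪ L ⊆ Set.Icc (sInf (K ∪ L)) (sSup (K ∪ L)) := fun x hx =>
    ⟨csInf_le hKL.bddBelow hx, le_csSup hKL.bddAbove hx⟩
  refine ⟨sInf (K ∪ L), sSup (K ∪ L), ?_, Set.subset_union_left.trans hsub,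
    Set.subset_union_right.trans hsub⟩
  exact hI.out (Set.union_subset hKI hLI (hKL.sInf_mem hn))
    (Set.union_subset hKI hLI (hKL.sSup_mem hn))

/-- If `w` is continuous and bounded below by `1/2`, its primitive is onto. -/
theorem surjective_primitive_of_half_le {w : ℝ → ℝ} (hw : Continuous w) (hlow : ∀ θ, 1 / 2 ≤ w θ) :
    Function.Surjective fun θ => ∫ τ in (0 : ℝ)..θ, w τ := by
  have hd : ∀ θ, HasDerivAt (fun θ => ∫ τ in (0 : ℝ)..θ, w τ) (w θ) θ := fun θ =>
    intervalIntegral.integral_hasDerivAt_right (hw.intervalIntegrable _ _)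
      (hw.stronglyMeasurableAtFilter _ _) hw.continuousAt
  have hm : Monotone fun θ => (∫ τ in (0 : ℝ)..θ, w τ) - 1 / 2 * θ := by
    have hd' : ∀ θ, HasDerivAt (fun θ => (∫ τ in (0 : ℝ)..θ, w τ) - 1 / 2 * θ)
        (w θ - 1 / 2 * 1) θ := fun θ => (hd θ).sub ((hasDerivAt_id θ).const_mul (1 / 2))
    refine monotone_of_deriv_nonneg (fun θ => (hd' θ).differentiableAt) fun θ => ?_
    rw [(hd' θ).deriv]
    linarith [hlow θ]
  intro t
  have habs : (0 : ℝ) ≤ 2 * |t| := by positivity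
  have h1 := hm habs
  have h2 := hm (neg_nonpos.mpr habs)
  simp only [intervalIntegral.integral_same, mul_zero, sub_zero] at h1 h2
  obtain ⟨θ, -, hθ⟩ := intermediate_value_Icc (neg_le_self habs)
    (fun θ _ => (hd θ).continuousAt.continuousWithinAt)
    (show t ∈ Set.Icc (∫ τ in (0 : ℝ)..(-(2 * |t|)), w τ) (∫ τ in (0 : ℝ)..(2 * |t|), w τ) from
      ⟨by linarith [neg_abs_le t], by linarith [le_abs_self t]⟩)
  exact ⟨θ, hθ⟩

/-- The factor `w` is the speed `dt/dθ` of the change of time; its bound makes the Lipschitz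
constant uniform in `θ`, as ODE uniqueness requires. -/
theorem LipschitzOnWith.newton_field {g : ℝ → ℝ} {K : NNReal} {s : Set ℝ}
    (hg : LipschitzOnWith K g s) {w : ℝ} (hw : |w| ≤ 2) :
    LipschitzOnWith (2 * max 1 K) (fun z : ℝ × ℝ => w • (z.2, -g z.1)) (s ×ˢ Set.univ) := by
  refine LipschitzOnWith.of_dist_le_mul fun x hx y hy => ?_
  have h1 := hg.dist_le_mul x.1 hx.1 y.1 hy.1
  have hx1 : dist x.1 y.1 ≤ dist x y := le_max_left _ _
  have hx2 : dist x.2 y.2 ≤ dist x y := le_max_right _ _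
  have hd : (0 : ℝ) ≤ dist x y := dist_nonneg
  have hK : (0 : ℝ) ≤ K := K.2
  have h3 : dist (x.2, -g x.1) (y.2, -g y.1) ≤ max 1 (K : ℝ) * dist x y := by
    rw [Prod.dist_eq, dist_neg_neg]
    refine max_le ?_ ?_
    · calc dist x.2 y.2 ≤ 1 * dist x y := by linarith
        _ ≤ _ := by gcongr; exact le_max_left _ _
    · calc dist (g x.1) (g y.1) ≤ K * dist x y := h1.trans (by gcongr)
        _ ≤ _ := by gcongr; exact le_max_right _ _
  rw [dist_smul₀, Real.norm_eq_abs]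
  push_cast
  calc |w| * dist (x.2, -g x.1) (y.2, -g y.1) ≤ 2 * (max 1 (K : ℝ) * dist x y) := by gcongr
    _ = _ := by ring

/-- The orbit through `(0, r)` in the coordinates `x = X(r sin θ)`, `y = r cos θ`: its minimal
period is `∫₀^{2π} X'(r sin θ) dθ`. -/
theorem IsMinimalPeriod.eq_integral {I : Set ℝ} (hI : I.OrdConnected) {g : ℝ → ℝ}
    (hg : AnalyticOnNhd ℝ g I) {X X' : ℝ → ℝ} {r T : ℝ} (hr : 0 < r)
    (hX : ∀ s ∈ Set.Icc (-r) r, HasDerivAt X (X' s) s ∧ X s ∈ I ∧ g (X s) * X' s = s ∧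
      1 / 2 ≤ X' s ∧ X' s ≤ 2)
    (hXc : ContinuousOn X' (Set.Icc (-r) r)) (hX0 : ∀ s ∈ Set.Icc (-r) r, X s = 0 ↔ s = 0)
    {γ : ℝ → ℝ × ℝ} (hγ : IsSolution I g γ) (hγ0 : γ 0 = (0, r)) (hT : IsMinimalPeriod γ T) :
    ∫ θ in (0 : ℝ)..(2 * Real.pi), X' (r * Real.sin θ) = T := by
  have hmem : ∀ θ, r * Real.sin θ ∈ Set.Icc (-r) r := fun θ => by
    constructor <;> nlinarith [Real.neg_one_le_sin θ, Real.sin_le_one θ]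
  -- From `dx = y dt` with `x = X(r sin θ)`, `y = r cos θ` comes `dt = X'(r sin θ) dθ`; `Θ` is time
  -- as a function of the angle.
  set w : ℝ → ℝ := fun θ => X' (r * Real.sin θ) with hw
  set Θ : ℝ → ℝ := fun θ => ∫ τ in (0 : ℝ)..θ, w τ with hΘ
  set η : ℝ → ℝ × ℝ := fun θ => (X (r * Real.sin θ), r * Real.cos θ) with hη
  have hwc : Continuous w :=
    hXc.comp_continuous (continuous_const.mul Real.continuous_sin) hmem
  have hwlow : ∀ θ, 1 / 2 ≤ w θ := fun θ => (hX _ (hmem θ)).2.2.2.1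
  have hwup : ∀ θ, w θ ≤ 2 := fun θ => (hX _ (hmem θ)).2.2.2.2
  have hΘd : ∀ θ, HasDerivAt Θ (w θ) θ := fun θ =>
    intervalIntegral.integral_hasDerivAt_right (hwc.intervalIntegrable _ _)
      (hwc.stronglyMeasurableAtFilter _ _) hwc.continuousAt
  have hΘ0 : Θ 0 = 0 := intervalIntegral.integral_same
  have hΘsurj : Function.Surjective Θ := surjective_primitive_of_half_le hwc hwlow
  have hΘmono : StrictMono Θ := strictMono_of_deriv_pos fun θ => by
    rw [(hΘd θ).deriv]
    linarith [hwlow θ]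
  have hwp : Function.Periodic w (2 * Real.pi) := fun θ => by simp [hw]
  have hΘadd : ∀ θ, Θ (θ + 2 * Real.pi) = Θ θ + Θ (2 * Real.pi) := fun θ => by
    have := hwp.intervalIntegral_add_eq_add 0 θ fun _ _ => hwc.intervalIntegrable _ _
    simpa [hΘ] using this
  have hγc : Continuous fun t => (γ t).1 :=
    continuous_fst.comp (continuous_iff_continuousAt.mpr fun t => (hγ t).2.continuousAt)
  -- A Lipschitz constant needs a compact interval containing both curves; one period of `γ`
  -- suffices.
  obtain ⟨c, d, hcd, hγcd, hXcd⟩ := IsCompact.exists_Icc_of_ordConnected hI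
    (isCompact_Icc.image (f := fun t => (γ t).1) (s := Set.Icc 0 T) hγc)
    (isCompact_Icc.image_of_continuousOn (f := X) (s := Set.Icc (-r) r)
      fun s hs => (hX s hs).1.continuousAt.continuousWithinAt)
    ((Set.nonempty_Icc.mpr hT.1.1.le).image _)
    (by rintro _ ⟨t, -, rfl⟩; exact (hγ t).1) (by rintro _ ⟨s, hs, rfl⟩; exact (hX s hs).2.1)
  obtain ⟨K, hK⟩ := (hg.mono hcd).exists_lipschitzOnWith_Icc
  have hγmem : ∀ t, (γ t).1 ∈ Set.Icc c d := fun t => by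
    obtain ⟨u, hu, hut⟩ := hT.1.2.exists_mem_Ico₀ hT.1.1 t
    rw [hut]
    exact hγcd ⟨u, Set.Ico_subset_Icc_self hu, rfl⟩
  have hγη : (fun θ => γ (Θ θ)) = η := by
    refine ODE_solution_unique_univ (t₀ := 0) (v := fun θ z => w θ • (z.2, -g z.1))
      (s := fun _ => Set.Icc c d ×ˢ Set.univ) (fun θ => hK.newton_field
        (abs_le.mpr ⟨by linarith [hwlow θ], hwup θ⟩)) (fun θ => ⟨?_, hγmem _, trivial⟩)
      (fun θ => ⟨?_, hXcd ⟨_, hmem θ, rfl⟩, trivial⟩) ?_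
    · exact (hγ (Θ θ)).2.scomp θ (hΘd θ)
    · have h1 := (hX _ (hmem θ)).1.comp θ ((Real.hasDerivAt_sin θ).const_mul r)
      have h2 := (Real.hasDerivAt_cos θ).const_mul r
      convert! h1.prodMk h2 using 1
      have h3 := (hX _ (hmem θ)).2.2.1
      simp only [hη, hw, Prod.smul_mk, smul_eq_mul]
      congr 1
      linarith
    · simp only [hΘ0, hγ0, hη, Real.sin_zero, mul_zero, Real.cos_zero, mul_one]
      rw [(hX0 0 ⟨by linarith, hr.le⟩).mpr rfl]
  have hγη' : ∀ θ, γ (Θ θ) = η θ := fun θ => congrFun hγη θ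
  suffices h : IsMinimalPeriod γ (Θ (2 * Real.pi)) from IsLeast.unique h hT
  refine ⟨⟨?_, ?_⟩, ?_⟩
  · exact hΘ0 ▸ hΘmono Real.two_pi_pos
  · intro t
    obtain ⟨θ, rfl⟩ := hΘsurj t
    rw [← hΘadd, hγη', hγη']
    simp [hη]
  -- A period `Θ θ` brings the orbit back to `(0, r)`, which forces `cos θ = 1` and so `θ ≥ 2π`.
  · rintro S ⟨hS, hSp⟩
    obtain ⟨θ, rfl⟩ := hΘsurj S
    have hθ : 0 < θ := hΘmono.lt_iff_lt.mp (by rw [hΘ0]; exact hS)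
    have h1 := hSp 0
    rw [zero_add, hγη', hγ0] at h1
    have h2 : X (r * Real.sin θ) = 0 := congrArg Prod.fst h1
    have h3 : r * Real.cos θ = r := congrArg Prod.snd h1
    have h4 : Real.cos θ = 1 := by
      apply mul_left_cancel₀ hr.ne'
      rw [h3, mul_one]
    obtain ⟨k, hk⟩ := (Real.cos_eq_one_iff θ).mp h4
    have hk0 : 0 < k := by
      have : (0 : ℝ) < k := by
        rw [← hk] at hθ
        exact (mul_pos_iff_of_pos_right Real.two_pi_pos).mp hθ
      exact_mod_cast this
    have hk1 : (1 : ℝ) ≤ k := by exact_mod_cast hk0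
    refine hΘmono.monotone ?_
    rw [← hk]
    nlinarith [Real.two_pi_pos]

/-! ### Abel's equation and the reflection identity -/

theorem integral_comp_mul_sin_neg (f : ℝ → ℝ) (r : ℝ) :
    ∫ θ in (0 : ℝ)..(2 * Real.pi), f (-(r * Real.sin θ)) =
      ∫ θ in (0 : ℝ)..(2 * Real.pi), f (r * Real.sin θ) := by
  have := intervalIntegral.integral_comp_sub_left (a := 0) (b := 2 * Real.pi)
    (fun θ => f (r * Real.sin θ)) (2 * Real.pi)
  simpa [Real.sin_two_pi_sub] using this

/-- An even continuous function positive at `r` and without zeros in `(0, r]` has a positive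
integral along `r sin θ`. -/
theorem integral_comp_mul_sin_pos {E : ℝ → ℝ} {r : ℝ} (hr : 0 < r)
    (hE : ContinuousOn E (Set.Icc (-r) r)) (heven : ∀ s ∈ Set.Icc (-r) r, E (-s) = E s)
    (hne : ∀ s ∈ Set.Ioc 0 r, E s ≠ 0) (hpos : 0 < E r) :
    0 < ∫ θ in (0 : ℝ)..(2 * Real.pi), E (r * Real.sin θ) := by
  have h1 : ∀ s ∈ Set.Ioc 0 r, 0 < E s := by
    intro s hs
    by_contra! hle
    obtain ⟨u, hu, hu0⟩ := intermediate_value_Icc hs.2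
      (hE.mono (Set.Icc_subset_Icc_left (by linarith [hs.1]))) ⟨hle, hpos.le⟩
    exact hne u ⟨hs.1.trans_le hu.1, hu.2⟩ hu0
  have h2 : ∀ s ∈ Set.Ioc 0 r, 0 ≤ E s := fun s hs => (h1 s hs).le
  have h0 : 0 ≤ E 0 := by
    have hc : ContinuousOn E (Set.Icc 0 r) := hE.mono (Set.Icc_subset_Icc_left (by linarith))
    by_contra! hlt
    obtain ⟨u, hu, hu0⟩ := intermediate_value_Icc hr.le hc ⟨hlt.le, hpos.le⟩
    rcases hu.1.eq_or_lt with rfl | h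
    · exact hlt.ne hu0
    · exact hne u ⟨h, hu.2⟩ hu0
  have h3 : ∀ s ∈ Set.Icc (-r) r, 0 ≤ E s := by
    intro s hs
    rcases lt_trichotomy s 0 with h | rfl | h
    · rw [← heven s hs]
      exact h2 _ ⟨by linarith, by linarith [hs.1]⟩
    · exact h0
    · exact h2 s ⟨h, hs.2⟩
  have hmem : ∀ θ, r * Real.sin θ ∈ Set.Icc (-r) r := fun θ => by
    constructor <;> nlinarith [Real.neg_one_le_sin θ, Real.sin_le_one θ]
  refine intervalIntegral.integral_pos Real.two_pi_pos
    (hE.comp_continuous (continuous_const.mul Real.continuous_sin) hmem).continuousOn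
    (fun θ _ => h3 _ (hmem θ)) ⟨Real.pi / 2, ⟨by positivity, by linarith [Real.pi_pos]⟩, ?_⟩
  simpa using hpos

/-- Uniqueness in Abel's equation for even analytic functions. -/
theorem AnalyticAt.eventually_eq_zero_of_integral_comp_mul_sin {E : ℝ → ℝ}
    (hE : AnalyticAt ℝ E 0) (heven : ∀ s, E (-s) = E s)
    (hint : ∀ᶠ r in 𝓝[>] 0, ∫ θ in (0 : ℝ)..(2 * Real.pi), E (r * Real.sin θ) = 0) :
    ∀ᶠ s in 𝓝 0, E s = 0 := by
  -- Otherwise the zeros are isolated: `E` has constant sign on some `(0, r]`, hence by evenness a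
  -- nonzero integral.
  refine hE.eventually_eq_zero_or_eventually_ne_zero.resolve_right fun hne => ?_
  obtain ⟨ε, hε, hball⟩ := Metric.eventually_nhds_iff_ball.mp
    (hE.eventually_analyticAt.and (eventually_nhdsWithin_iff.mp hne))
  have hpos : ∀ᶠ r in 𝓝[>] (0 : ℝ), 0 < r := self_mem_nhdsWithin
  have hsmall : ∀ᶠ r in 𝓝[>] (0 : ℝ), r < ε :=
    (eventually_lt_nhds hε).filter_mono nhdsWithin_le_nhds
  obtain ⟨r, hr0, hr, hri⟩ := (hpos.and (hsmall.and hint)).exists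
  have hin : ∀ s ∈ Set.Icc (-r) r, s ∈ Metric.ball (0 : ℝ) ε := fun s hs => by
    rw [mem_ball_zero_iff, Real.norm_eq_abs]
    exact (abs_le.mpr hs).trans_lt hr
  have hc : ContinuousOn E (Set.Icc (-r) r) := fun s hs =>
    (hball s (hin s hs)).1.continuousAt.continuousWithinAt
  have hz : ∀ s ∈ Set.Ioc 0 r, E s ≠ 0 := fun s hs =>
    (hball s (hin s ⟨by linarith [hs.1], hs.2⟩)).2 hs.1.ne'
  rcases (hz r ⟨hr0, le_rfl⟩).lt_or_gt with h | h
  · have := integral_comp_mul_sin_pos hr0 hc.neg (fun s _ => by simp [heven])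
      (fun s hs => neg_ne_zero.mpr (hz s hs)) (neg_pos.mpr h)
    simp [hri] at this
  · exact (integral_comp_mul_sin_pos hr0 hc (fun s _ => heven s) hz h).ne' hri

/-- For an isochronous center, `X(s) - X(-s) = 2 s` where `x = X(s)` is the coordinate with
`G(X(s)) = s²/2`. -/
theorem IsIsochronous.sub_eq_two_mul {I : Set ℝ} (hIo : IsOpen I) (hI : I.OrdConnected)
    {g G : ℝ → ℝ} (hg : AnalyticOnNhd ℝ g I) (hG : ∀ x ∈ I, HasDerivAt G (g x) x) (hG0 : G 0 = 0)
    (hI0 : (0 : ℝ) ∈ I) (hiso : IsIsochronous I g) {X : ℝ → ℝ} (hX : AnalyticAt ℝ X 0)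
    (hX0 : X 0 = 0) (hX1 : deriv X 0 = 1) (hGX : ∀ᶠ s in 𝓝 0, G (X s) = s ^ 2 / 2) :
    ∀ᶠ s in 𝓝 0, X s - X (-s) = 2 * s := by
  obtain ⟨T, U, hU, hsol⟩ := hiso
  have hlow : ∀ᶠ s in 𝓝 (0 : ℝ), 1 / 2 ≤ deriv X s :=
    hX.deriv.continuousAt (Ici_mem_nhds (by rw [hX1]; norm_num))
  have hup : ∀ᶠ s in 𝓝 (0 : ℝ), deriv X s ≤ 2 :=
    hX.deriv.continuousAt (Iic_mem_nhds (by rw [hX1]; norm_num))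
  have hmemI : ∀ᶠ s in 𝓝 (0 : ℝ), X s ∈ I :=
    hX.continuousAt.eventually (hIo.mem_nhds (by rwa [hX0]))
  have hUr : ∀ᶠ r in 𝓝 (0 : ℝ), ((0 : ℝ), r) ∈ U :=
    (Continuous.prodMk_right (0 : ℝ)).continuousAt.eventually hU
  obtain ⟨ε, hε, hball⟩ := Metric.eventually_nhds_iff_ball.mp
    (hX.eventually_analyticAt.and (hlow.and (hup.and (hmemI.and
      (hGX.eventually_nhds.and hUr)))))
  have hper : ∀ r, 0 < r → r < ε →
      ∫ θ in (0 : ℝ)..(2 * Real.pi), deriv X (r * Real.sin θ) = T := by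
    intro r hr hrε
    have hin : ∀ s ∈ Set.Icc (-r) r, s ∈ Metric.ball (0 : ℝ) ε := fun s hs => by
      rw [mem_ball_zero_iff, Real.norm_eq_abs]
      exact (abs_le.mpr hs).trans_lt hrε
    obtain ⟨γ, hγ, hγ0, hγT⟩ := hsol (0, r) (hball r (hin r ⟨by linarith, le_rfl⟩)).2.2.2.2.2
      (by simp [hr.ne'])
    refine IsMinimalPeriod.eq_integral (X := X) hI hg hr (fun s hs => ?_) (fun s hs => ?_)
      (fun s hs => ⟨fun h => ?_, fun h => by rw [h, hX0]⟩) hγ hγ0 hγT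
    · obtain ⟨ha, h1, h2, h3, h4, -⟩ := hball s (hin s hs)
      have hd := ha.differentiableAt.hasDerivAt
      refine ⟨hd, h3, ?_, h1, h2⟩
      have e1 : HasDerivAt (fun s => G (X s)) (g (X s) * deriv X s) s := (hG _ h3).comp s hd
      have e2 : HasDerivAt (fun s : ℝ => s ^ 2 / 2) s s := by
        convert! (hasDerivAt_pow 2 s).div_const 2 using 1
        simp
      exact (e1.congr_of_eventuallyEq (h4.mono fun _ h => h.symm)).unique e2
    · exact (hball s (hin s hs)).1.deriv.continuousAt.continuousWithinAt
    · have h4 := (hball s (hin s hs)).2.2.2.2.1.self_of_nhds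
      rw [h, hG0] at h4
      exact pow_eq_zero_iff two_ne_zero |>.mp (by linarith)
  -- The two derivative terms each integrate to `T`, and the constant `T/π` over `[0, 2π]` removes
  -- `2T`.
  have hEan : AnalyticAt ℝ (fun s => deriv X s + deriv X (-s) - T / Real.pi) 0 := by
    have : AnalyticAt ℝ (fun s => deriv X (-s)) 0 :=
      AnalyticAt.comp (g := deriv X) (by simpa using hX.deriv) analyticAt_id.neg
    exact (hX.deriv.add this).sub analyticAt_const
  have hE := hEan.eventually_eq_zero_of_integral_comp_mul_sin (fun s => by rw [neg_neg]; ring) (by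
    filter_upwards [self_mem_nhdsWithin, (eventually_lt_nhds hε).filter_mono nhdsWithin_le_nhds]
      with r hr hrε
    have hr : 0 < r := hr
    have hc : ∀ k : ℝ, |k| ≤ 1 → Continuous fun θ => deriv X (k * (r * Real.sin θ)) := by
      intro k hk
      refine continuous_iff_continuousAt.mpr fun θ => ?_
      have hin : k * (r * Real.sin θ) ∈ Metric.ball (0 : ℝ) ε := by
        rw [mem_ball_zero_iff, Real.norm_eq_abs, abs_mul, abs_mul, abs_of_pos hr]
        have := Real.abs_sin_le_one θ
        have h5 : r * |Real.sin θ| ≤ r := by nlinarith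
        have h6 : |k| * (r * |Real.sin θ|) ≤ 1 * r := by gcongr
        linarith
      exact ContinuousAt.comp (g := deriv X) (f := fun θ => k * (r * Real.sin θ))
        (hball _ hin).1.deriv.continuousAt (by fun_prop)
    have hc1 : Continuous fun θ => deriv X (r * Real.sin θ) := by simpa using hc 1 (by simp)
    have hc2 : Continuous fun θ => deriv X (-(r * Real.sin θ)) := by simpa using hc (-1) (by simp)
    rw [intervalIntegral.integral_sub ((hc1.fun_add hc2).intervalIntegrable _ _)
      (continuous_const.intervalIntegrable _ _),
      intervalIntegral.integral_add (hc1.intervalIntegrable _ _) (hc2.intervalIntegrable _ _),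
      integral_comp_mul_sin_neg, hper r hr hrε]
    simp only [intervalIntegral.integral_const, smul_eq_mul, sub_zero]
    field_simp
    ring)
  have hTpi : T / Real.pi = 2 := by
    have := hE.self_of_nhds
    simp only [neg_zero, hX1] at this
    linarith
  obtain ⟨δ, hδ, hballδ⟩ := Metric.eventually_nhds_iff_ball.mp (hE.and hX.eventually_analyticAt)
  have hneg : ∀ s ∈ Metric.ball (0 : ℝ) δ, -s ∈ Metric.ball (0 : ℝ) δ := fun s hs => by
    simpa using hs
  have hder : ∀ s ∈ Metric.ball (0 : ℝ) δ,
      HasDerivAt (fun s => X s - X (-s)) 2 s := fun s hs => by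
    have h1 := (hballδ s hs).2.differentiableAt.hasDerivAt
    have h2 := (hballδ _ (hneg s hs)).2.differentiableAt.hasDerivAt.comp s (hasDerivAt_neg s)
    have h3 := (hballδ s hs).1
    convert! h1.sub h2 using 1
    simp only [hTpi] at h3
    linarith
  have hlin : ∀ s : ℝ, HasDerivAt (fun s : ℝ => 2 * s) 2 s := fun s => by
    simpa using (hasDerivAt_id s).const_mul (2 : ℝ)
  have heq := Metric.isOpen_ball.eqOn_of_deriv_eq (𝕜 := ℝ) (convex_ball (0 : ℝ) δ).isPreconnected
    (fun s hs => (hder s hs).differentiableAt.differentiableWithinAt)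
    (fun s _ => (hlin s).differentiableAt.differentiableWithinAt)
    (fun s hs => by rw [(hder s hs).deriv, (hlin s).deriv]) (Metric.mem_ball_self hδ) (by simp)
  exact Metric.eventually_nhds_iff_ball.mpr ⟨δ, hδ, heq⟩

/-! ### Isotonic potentials are isochronous -/

theorem cos_sin_combination_sq_le (B C t : ℝ) :
    (B * Real.cos t + C * Real.sin t) ^ 2 ≤ B ^ 2 + C ^ 2 := by
  have h : (B * Real.cos t + C * Real.sin t) ^ 2 + (C * Real.cos t - B * Real.sin t) ^ 2 =
      B ^ 2 + C ^ 2 := by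
    linear_combination (B ^ 2 + C ^ 2) * Real.sin_sq_add_cos_sq t
  nlinarith [sq_nonneg (C * Real.cos t - B * Real.sin t)]

/-- Periodicity at `0` and `π/2` gives two linear equations in `cos S`, `sin S`; eliminating `sin S`
yields `(B² + C²)(cos S - 1) = 0`. -/
theorem two_pi_le_of_periodic_combination {B C S : ℝ} (hBC : B ^ 2 + C ^ 2 ≠ 0) (hS : 0 < S)
    (h : Function.Periodic (fun t => B * Real.cos t + C * Real.sin t) S) : 2 * Real.pi ≤ S := by
  have h0 := h 0
  have h1 := h (Real.pi / 2)
  simp only [zero_add, Real.cos_zero, Real.sin_zero, Real.cos_pi_div_two, Real.sin_pi_div_two,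
    add_comm (Real.pi / 2) S, Real.cos_add_pi_div_two, Real.sin_add_pi_div_two] at h0 h1
  have hcos : Real.cos S = 1 := by
    apply mul_left_cancel₀ hBC
    linear_combination B * h0 + C * h1
  obtain ⟨k, hk⟩ := (Real.cos_eq_one_iff S).mp hcos
  have hk0 : 0 < k := by
    have : (0 : ℝ) < k := by
      rw [← hk] at hS
      exact (mul_pos_iff_of_pos_right Real.two_pi_pos).mp hS
    exact_mod_cast this
  have hk1 : (1 : ℝ) ≤ k := by exact_mod_cast hk0
  rw [← hk]
  nlinarith [Real.two_pi_pos]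

/-- The isotonic potentials are isochronous: `(α x + 1)²` moves harmonically. -/
theorem IsIsochronous.of_isotonic {I : Set ℝ} (hIo : IsOpen I) (hI : I.OrdConnected)
    (hI0 : (0 : ℝ) ∈ I) {g G : ℝ → ℝ} (hG : ∀ x ∈ I, HasDerivAt G (g x) x) {α : ℝ} (hα : α ≠ 0)
    (h : ∀ x ∈ I, α * x + 1 ≠ 0 ∧
      G x = 1 / (8 * α ^ 2) * (α * x + 1 - 1 / (α * x + 1)) ^ 2) :
    IsIsochronous I g := by
  have hpos : ∀ x ∈ I, 0 < α * x + 1 := by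
    intro x hx
    by_contra! hle
    obtain ⟨z, hz, hz0⟩ := hI.isPreconnected.intermediate_value hx hI0
      (f := fun x => α * x + 1) (by fun_prop) ⟨hle, by norm_num⟩
    exact (h z hz).1 hz0
  have hg : ∀ x ∈ I, g x = (α * x + 1 - 1 / (α * x + 1) ^ 3) / (4 * α) := by
    intro x hx
    have hu := (h x hx).1
    have h1 : HasDerivAt (fun x => α * x + 1) α x := by
      simpa using ((hasDerivAt_id x).const_mul α).add_const 1
    have h2 := (((h1.sub (h1.inv hu)).pow 2).const_mul (1 / (8 * α ^ 2)))
    have h3 : G =ᶠ[𝓝 x] fun x => 1 / (8 * α ^ 2) * (α * x + 1 - (α * x + 1)⁻¹) ^ 2 := by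
      filter_upwards [hIo.mem_nhds hx] with y hy
      rw [(h y hy).2, one_div (α * y + 1)]
    rw [(hG x hx).unique (h2.congr_of_eventuallyEq h3)]
    simp only [Pi.sub_apply, Pi.inv_apply, Nat.add_one_sub_one, pow_one, Nat.cast_ofNat]
    generalize α * x + 1 = z at hu
    field_simp
    ring
  obtain ⟨δ, hδ, hball⟩ := Metric.isOpen_iff.mp hIo 0 hI0
  -- This is `1 + 4α²(y²/2 + G(x))`, an affine function of the energy.
  set A : ℝ × ℝ → ℝ := fun p => 2 * (α * p.2) ^ 2 +
    ((α * p.1 + 1) ^ 2 + ((α * p.1 + 1) ^ 2)⁻¹) / 2 with hA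
  have hAc : ContinuousAt (fun p => 4 * A p * (A p - 1)) 0 := by
    have : ContinuousAt A 0 := by
      refine ContinuousAt.add (by fun_prop) (ContinuousAt.div_const (ContinuousAt.add (by fun_prop)
        (ContinuousAt.inv₀ (by fun_prop) (by simp))) 2)
    exact (this.const_mul 4).mul (this.sub continuousAt_const)
  have hA0 : 4 * A 0 * (A 0 - 1) = 0 := by simp [hA]
  -- `4A(A - 1)` bounds `(w - 1)²` along the orbit, which keeps `x` within `δ` of `0`, inside `I`.
  have hU1 : ∀ᶠ p in 𝓝 (0 : ℝ × ℝ), 4 * A p * (A p - 1) < (α * δ) ^ 2 :=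
    hAc.eventually (gt_mem_nhds (by simp only [hA0]; positivity))
  have hU2 : ∀ᶠ p in 𝓝 (0 : ℝ × ℝ), p.1 ∈ I := continuousAt_fst.eventually (hIo.mem_nhds hI0)
  refine ⟨2 * Real.pi, _, hU1.and hU2, ?_⟩
  rintro ⟨x₀, y₀⟩ ⟨hp1, hp2 : x₀ ∈ I⟩ hp0
  have hu0 := hpos x₀ hp2
  obtain ⟨a, ha⟩ : ∃ a, a = A (x₀, y₀) := ⟨_, rfl⟩
  obtain ⟨u, hu⟩ : ∃ u, u = α * x₀ + 1 := ⟨_, rfl⟩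
  change 4 * A (x₀, y₀) * (A (x₀, y₀) - 1) < (α * δ) ^ 2 at hp1
  rw [← ha] at hp1
  rw [← hu] at hu0
  have ha' : a = 2 * (α * y₀) ^ 2 + (u ^ 2 + (u ^ 2)⁻¹) / 2 := by rw [ha, hu]
  -- `B` and `C` fit the initial data of `w = (αx + 1)²`: `w(0) = u²`, `w'(0) = 2uαy₀`.
  obtain ⟨B, hB⟩ : ∃ B, B = u ^ 2 - a := ⟨_, rfl⟩
  obtain ⟨C, hC⟩ : ∃ C, C = 2 * u * (α * y₀) := ⟨_, rfl⟩
  -- The amplitude `√(B² + C²)` is thus below the mean `a`, so `w` stays positive.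
  have hABC : a ^ 2 = B ^ 2 + C ^ 2 + 1 := by
    rw [hB, hC]
    have : 2 * a * u ^ 2 = 4 * (α * y₀) ^ 2 * u ^ 2 + u ^ 4 + 1 := by
      rw [ha']
      field_simp
      ring
    linear_combination this
  have hapos : 0 < a := by rw [ha']; positivity
  have ha1 : 1 ≤ a := by nlinarith [sq_nonneg B, sq_nonneg C]
  set w : ℝ → ℝ := fun t => a + (B * Real.cos t + C * Real.sin t) with hw
  set w' : ℝ → ℝ := fun t => C * Real.cos t - B * Real.sin t with hw'
  have hsq : ∀ t, w' t ^ 2 = 2 * a * w t - w t ^ 2 - 1 := fun t => by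
    simp only [hw, hw']
    linear_combination (B ^ 2 + C ^ 2) * Real.sin_sq_add_cos_sq t - hABC
  have hwpos : ∀ t, 0 < w t := fun t => by
    have h1 := cos_sin_combination_sq_le B C t
    have h2 : |B * Real.cos t + C * Real.sin t| < a := abs_lt_of_sq_lt_sq (by linarith) hapos.le
    have h3 := (abs_lt.mp h2).1
    simp only [hw]
    linarith
  have hwd : ∀ t, HasDerivAt w (w' t) t := fun t => by
    convert! (((Real.hasDerivAt_cos t).const_mul B).add
      ((Real.hasDerivAt_sin t).const_mul C)).const_add a using 1
    simp only [hw']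
    ring
  have hwd' : ∀ t, HasDerivAt w' (a - w t) t := fun t => by
    convert! ((Real.hasDerivAt_cos t).const_mul C).sub
      ((Real.hasDerivAt_sin t).const_mul B) using 1
    simp only [hw]
    ring
  have hxI : ∀ t, (√(w t) - 1) / α ∈ I := fun t => by
    refine hball ?_
    rw [mem_ball_zero_iff, Real.norm_eq_abs, abs_div, div_lt_iff₀ (abs_pos.mpr hα)]
    have h1 := hsq t
    have h2 := hwpos t
    have h3 : w t ≤ 2 * a := by nlinarith [sq_nonneg (w' t)]
    have h4 : (w t - 1) ^ 2 < (α * δ) ^ 2 := by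
      nlinarith [sq_nonneg (w' t), mul_nonneg (sub_nonneg.mpr h3) (sub_nonneg.mpr ha1)]
    have h5 := Real.sq_sqrt h2.le
    have h6 := Real.sqrt_nonneg (w t)
    have h7 : (√(w t) - 1) ^ 2 ≤ (w t - 1) ^ 2 := by
      have : w t - 1 = (√(w t) - 1) * (√(w t) + 1) := by linear_combination -h5
      rw [this, mul_pow]
      nlinarith [sq_nonneg (√(w t) - 1), mul_nonneg (sq_nonneg (√(w t) - 1)) h6,
        mul_nonneg (sq_nonneg (√(w t) - 1)) (sq_nonneg (√(w t)))]
    have h8 := sq_lt_sq.mp (h7.trans_lt h4)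
    rwa [abs_mul, abs_of_pos hδ, mul_comm] at h8
  refine ⟨fun t => ((√(w t) - 1) / α, w' t / (2 * √(w t)) / α), fun t => ⟨hxI t, ?_⟩, ?_,
    ⟨Real.two_pi_pos, fun t => ?_⟩, ?_⟩
  · have hs : 0 < √(w t) := Real.sqrt_pos.mpr (hwpos t)
    have h1 := (hwd t).sqrt (hwpos t).ne'
    have h2 := (h1.sub_const 1).div_const α
    have h3 := ((hwd' t).div (h1.const_mul 2) (by positivity)).div_const α
    have h4 := Real.sq_sqrt (hwpos t).le
    convert! h2.prodMk h3 using 1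
    congr 1
    rw [hg _ (hxI t)]
    have h5 : α * ((√(w t) - 1) / α) + 1 = √(w t) := by field_simp; ring
    simp only [h5]
    have h6 := hsq t
    obtain ⟨q, hq⟩ : ∃ q, q = √(w t) := ⟨_, rfl⟩
    rw [← hq] at h4 hs ⊢
    rw [← h4] at h6 ⊢
    field_simp
    linear_combination (4 : ℝ) * h6
  · have hw0 : w 0 = u ^ 2 := by simp [hw, hB]
    have hw0' : w' 0 = 2 * u * (α * y₀) := by simp [hw', hC]
    simp only [hw0, hw0', Real.sqrt_sq hu0.le]
    congr 1
    · rw [hu]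
      field_simp
      ring
    · field_simp
  · simp [hw, hw']
  · rintro S ⟨hS, hSp⟩
    refine two_pi_le_of_periodic_combination (B := B) (C := C) (fun h0 => hp0 ?_) hS fun t => ?_
    · have hB0 : B = 0 := pow_eq_zero_iff two_ne_zero |>.mp
        (le_antisymm (by linarith [sq_nonneg C]) (sq_nonneg B))
      have hC0 : C = 0 := pow_eq_zero_iff two_ne_zero |>.mp
        (le_antisymm (by linarith [sq_nonneg B]) (sq_nonneg C))
      have ha2 : a = 1 := (pow_eq_one_iff_of_nonneg hapos.le two_ne_zero).mp (by linarith)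
      have hu1 : u = 1 := (pow_eq_one_iff_of_nonneg hu0.le two_ne_zero).mp (by linarith)
      rw [hC, hu1] at hC0
      have hx : α * x₀ = 0 := by linarith
      have hy : α * y₀ = 0 := by linarith
      rw [Prod.mk_eq_zero]
      exact ⟨(mul_eq_zero.mp hx).resolve_left hα, (mul_eq_zero.mp hy).resolve_left hα⟩
    · have h1 : (√(w (t + S)) - 1) / α = (√(w t) - 1) / α := congrArg Prod.fst (hSp t)
      have h2 := sub_left_injective ((div_left_inj' hα).mp h1)
      have h3 := (Real.sqrt_inj (hwpos _).le (hwpos _).le).mp h2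
      exact add_left_cancel h3

/-! ### The reflection is rational, hence Möbius -/

open Polynomial in
/-- If `x = Y(s)` satisfies `P(Y(s)) / Q(Y(s)) = s²/2` and `Y(s) - Y(-s) = 2 s`, then
`Y(-s)` is a rational function of `Y(s)`. -/
theorem Polynomial.exists_rational_reflection {P Q : ℝ[X]} (hQ0 : Q.eval 0 ≠ 0) {Y : ℝ → ℝ}
    (hY0 : Y 0 = 0) (hY1 : HasStrictDerivAt Y 1 0)
    (hPQ : ∀ᶠ s in 𝓝 0, s ^ 2 * Q.eval (Y s) = 2 * P.eval (Y s))
    (hrefl : ∀ᶠ s in 𝓝 0, Y s - Y (-s) = 2 * s) :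
    ∃ B C : ℝ[X], B ≠ 0 ∧ ∀ᶠ s in 𝓝 0, B.eval (Y s) * Y (-s) = C.eval (Y s) := by
  obtain ⟨A₁, B₁, N₁, h₁⟩ := exists_linear_of_sq_relation P Q P
  obtain ⟨A₂, B₂, N₂, h₂⟩ := exists_linear_of_sq_relation P Q Q
  -- `A + sB` is the reduced form of `P(x)Q(x + 2s) - Q(x)P(x + 2s)`, up to a power of `Q`.
  -- Replacing `s` by `-s` and using `G(Y(-s)) = G(Y(s))` gives `A = sB`.
  set A := P * Q ^ N₁ * A₂ - Q ^ (N₂ + 1) * A₁ with hA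
  set B := P * Q ^ N₁ * B₂ - Q ^ (N₂ + 1) * B₁ with hB
  have hneg : Tendsto (fun s : ℝ => -s) (𝓝 0) (𝓝 0) := by
    simpa using (continuous_neg (G := ℝ)).tendsto 0
  have hlin : ∀ᶠ s in 𝓝 0, A.eval (Y s) = s * B.eval (Y s) := by
    filter_upwards [hPQ, hneg.eventually hPQ, hrefl] with s hs hs' hr
    have e1 := h₁ (Y s) (-s) (by rw [neg_sq]; exact hs)
    have e2 := h₂ (Y s) (-s) (by rw [neg_sq]; exact hs)
    have hy : Y s + 2 * -s = Y (-s) := by linarith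
    rw [hy] at e1 e2
    simp only [hA, hB, eval_sub, eval_mul, eval_pow]
    linear_combination P.eval (Y s) * Q.eval (Y s) ^ N₁ * -e2 + Q.eval (Y s) ^ (N₂ + 1) * e1 +
      Q.eval (Y s) ^ (N₁ + N₂ + 1) / 2 * hs' -
      Q.eval (Y (-s)) * Q.eval (Y s) ^ (N₁ + N₂) / 2 * hs
  refine ⟨B, X * B - C 2 * A, fun hB0 => ?_, ?_⟩
  · have hQne : ∀ᶠ s in 𝓝 0, Q.eval (Y s) ≠ 0 := by
      have : ContinuousAt (fun s => Q.eval (Y s)) 0 :=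
        ContinuousAt.comp Q.continuous.continuousAt hY1.hasDerivAt.continuousAt
      exact this.eventually_ne (by simpa [hY0] using hQ0)
    have hmap : Filter.map Y (𝓝 0) = 𝓝 0 := by
      have := hY1.map_nhds_eq one_ne_zero
      rwa [hY0] at this
    have himage : ∀ᶠ z in 𝓝 (0 : ℝ), ∃ τ, Y τ = z ∧ τ ^ 2 * Q.eval z = 2 * P.eval z ∧
        Q.eval z ≠ 0 := by
      rw [← hmap, eventually_map]
      filter_upwards [hPQ, hQne] with τ h1 h2 using ⟨τ, rfl, h1, h2⟩
    have hw : Tendsto (fun s => Y s + 2 * s) (𝓝 0) (𝓝 0) := by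
      have : ContinuousAt (fun s => Y s + 2 * s) 0 :=
        hY1.hasDerivAt.continuousAt.add (by fun_prop)
      simpa [ContinuousAt, hY0] using this
    -- If `B = 0` then `A` vanishes too, so `G(Y(s) + 2s) = s²/2`. Hence `Y(s) + 2s` is `Y(s)` or
    -- `Y(-s) = Y(s) - 2s`, and `s = 0`.
    have hzero : ∀ᶠ s in 𝓝 (0 : ℝ), s = 0 := by
      filter_upwards [hPQ, hrefl, hlin, hQne, hw.eventually himage] with s hs hr hl hq hτ
      obtain ⟨τ, hτ1, hτ2, hτ3⟩ := hτ
      have e1 := h₁ (Y s) s hs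
      have e2 := h₂ (Y s) s hs
      have hBs : P.eval (Y s) * Q.eval (Y s) ^ N₁ * B₂.eval (Y s) -
          Q.eval (Y s) ^ (N₂ + 1) * B₁.eval (Y s) = 0 := by
        have := congrArg (eval (Y s)) (hB.symm.trans hB0)
        simpa only [eval_sub, eval_mul, eval_pow, eval_zero] using this
      rw [hB0, eval_zero, mul_zero] at hl
      simp only [hA, eval_sub, eval_mul, eval_pow] at hl
      have e3 : Q.eval (Y s) ^ (N₁ + N₂ + 1) *
          (s ^ 2 * Q.eval (Y s + 2 * s) - 2 * P.eval (Y s + 2 * s)) = 0 := by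
        linear_combination 2 * hl + 2 * s * hBs +
          2 * P.eval (Y s) * Q.eval (Y s) ^ N₁ * e2 - 2 * Q.eval (Y s) ^ (N₂ + 1) * e1 +
          Q.eval (Y s + 2 * s) * Q.eval (Y s) ^ (N₁ + N₂) * hs
      have e4 := (mul_eq_zero.mp e3).resolve_left (pow_ne_zero _ hq)
      have e5 : s ^ 2 = τ ^ 2 := mul_right_cancel₀ hτ3 (by linarith)
      rcases sq_eq_sq_iff_eq_or_eq_neg.mp e5 with h | h
      · rw [← h] at hτ1
        linarith
      · rw [← neg_eq_iff_eq_neg.mpr h] at hτ1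
        linarith
    have hmem : {(0 : ℝ)} ∈ 𝓝 (0 : ℝ) := hzero
    exact infinite_of_mem_nhds (0 : ℝ) hmem (Set.finite_singleton 0)
  · filter_upwards [hlin, hrefl] with s hl hr
    simp only [eval_sub, eval_mul, eval_X, eval_C]
    linear_combination 2 * hl - B.eval (Y s) * hr

open Polynomial in
/-- A rational potential that is half a square in a coordinate `s` with `Y(s) - Y(-s) = 2 s` is
isotonic or harmonic. -/
theorem Polynomial.exists_isotonic_identity {P Q : ℝ[X]} (hQ0 : Q.eval 0 ≠ 0) {Y : ℝ → ℝ}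
    (hY0 : Y 0 = 0) (hY1 : HasStrictDerivAt Y 1 0)
    (hPQ : ∀ᶠ s in 𝓝 0, s ^ 2 * Q.eval (Y s) = 2 * P.eval (Y s))
    (hrefl : ∀ᶠ s in 𝓝 0, Y s - Y (-s) = 2 * s) :
    ∃ β : ℝ, ∀ x : ℝ,
      8 * P.eval x * (1 + β * x) ^ 2 = Q.eval x * (x * (2 + β * x)) ^ 2 := by
  obtain ⟨B, D, hB, hBC⟩ := exists_rational_reflection hQ0 hY0 hY1 hPQ hrefl
  obtain ⟨b, c, hBd, hCd, hunit⟩ := _root_.extract_gcd B D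
  have hbc : IsCoprime b c := (gcd_isUnit_iff _ _).mp hunit
  have hd0 : GCDMonoid.gcd B D ≠ 0 := fun h => hB (by rw [hBd, h, zero_mul])
  set d := GCDMonoid.gcd B D with hd
  -- The common factor can be cancelled for `s ≠ 0` because `Y' (0) ≠ 0` makes `Y` avoid its
  -- finitely many roots there; `s = 0` is recovered by continuity.
  have hdY : ∀ᶠ s in 𝓝[≠] (0 : ℝ), d.eval (Y s) ≠ 0 := by
    have : ∀ᶠ s in 𝓝[≠] (0 : ℝ), ∀ ρ ∈ d.roots.toFinset, Y s ≠ ρ :=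
      (Finset.eventually_all _).mpr fun ρ _ => hY1.hasDerivAt.eventually_ne one_ne_zero
    filter_upwards [this] with s hs h0
    exact hs (Y s) (by simpa [hd0] using h0) rfl
  have hneg : Tendsto (fun s : ℝ => -s) (𝓝 0) (𝓝 0) := by
    simpa using (continuous_neg (G := ℝ)).tendsto 0
  have hYc : ContinuousAt Y 0 := hY1.hasDerivAt.continuousAt
  have hrat' : ∀ᶠ s in 𝓝[≠] (0 : ℝ), b.eval (Y s) * Y (-s) = c.eval (Y s) := by
    filter_upwards [hdY, hBC.filter_mono nhdsWithin_le_nhds] with s h1 h2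
    rw [hBd, hCd, eval_mul, eval_mul, mul_assoc] at h2
    exact mul_left_cancel₀ h1 h2
  have hYn : ContinuousAt (fun s => Y (-s)) 0 :=
    ContinuousAt.comp (by simpa using hYc) continuous_neg.continuousAt
  have hc0 : c.eval 0 = 0 := by
    have t1 : ContinuousAt (fun s => b.eval (Y s) * Y (-s)) 0 :=
      (ContinuousAt.comp b.continuous.continuousAt hYc).mul hYn
    have t2 : ContinuousAt (fun s => c.eval (Y s)) 0 :=
      ContinuousAt.comp c.continuous.continuousAt hYc
    have := tendsto_nhds_unique_of_eventuallyEq (t1.mono_left nhdsWithin_le_nhds)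
      (t2.mono_left nhdsWithin_le_nhds) hrat'
    simpa [hY0] using this.symm
  have hrat : ∀ᶠ s in 𝓝 (0 : ℝ), b.eval (Y s) * Y (-s) = c.eval (Y s) := by
    filter_upwards [eventually_nhdsWithin_iff.mp hrat'] with s hs
    rcases eq_or_ne s 0 with rfl | h
    · simp [hY0, hc0]
    · exact hs h
  have hmap : Filter.map Y (𝓝 0) = 𝓝 0 := by
    have := hY1.map_nhds_eq one_ne_zero
    rwa [hY0] at this
  have hS : {x | ∃ y, b.eval x * y = c.eval x ∧ b.eval y * x = c.eval y}.Infinite := by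
    refine infinite_of_mem_nhds (0 : ℝ) ?_
    rw [← hmap, Filter.mem_map]
    filter_upwards [hrat, hneg.eventually hrat] with s h1 h2
    exact ⟨Y (-s), h1, by simpa using h2⟩
  obtain ⟨k, b₀, b₁, hb₀, rfl, rfl⟩ := exists_moebius_of_involution hbc hc0 hS
    fun _ hx => hx
  have hne : ∀ᶠ s in 𝓝[≠] (0 : ℝ), s ≠ 0 := self_mem_nhdsWithin
  obtain ⟨s₀, h1, h2, h3, hs₀⟩ := ((hrat.filter_mono nhdsWithin_le_nhds).and
    (((hneg.eventually hrat).filter_mono nhdsWithin_le_nhds).and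
      ((hrefl.filter_mono nhdsWithin_le_nhds).and hne))).exists
  -- Subtracting the Möbius relations at `s₀` and `-s₀` cancels the `b₁` terms.
  have hk : k = -b₀ := by
    simp only [eval_add, eval_mul, eval_C, eval_X, neg_neg] at h1 h2
    have : (b₀ + k) * (2 * s₀) = 0 := by
      linear_combination h2 - h1 - (b₀ + k) * h3
    have := (mul_eq_zero.mp this).resolve_right (mul_ne_zero two_ne_zero hs₀)
    linarith
  refine ⟨b₁ / b₀, fun x => ?_⟩
  have hpoly : C 8 * P * (1 + C (b₁ / b₀) * X) ^ 2 = Q * (X * (2 + C (b₁ / b₀) * X)) ^ 2 := by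
    refine eq_of_infinite_eval_eq _ _ (infinite_of_mem_nhds (0 : ℝ) ?_)
    rw [← hmap, Filter.mem_map]
    filter_upwards [hrat, hPQ, hrefl] with s e1 e2 e3
    change eval (Y s) _ = eval (Y s) _
    simp only [eval_add, eval_mul, eval_C, eval_X, eval_pow, eval_one, eval_ofNat] at e1 ⊢
    obtain ⟨β, hβ⟩ : ∃ β, β = b₁ / b₀ := ⟨_, rfl⟩
    have hb₁ : b₁ = β * b₀ := by rw [hβ]; field_simp
    rw [← hβ]
    have e4 : (1 + β * Y s) * Y (-s) = -Y s := by
      apply mul_left_cancel₀ hb₀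
      rw [hk, hb₁] at e1
      linear_combination e1
    -- This is `2s = x - σ(x)` with `σ(x) = -x/(1 + βx)`.
    have e5 : 2 * s * (1 + β * Y s) = Y s * (2 + β * Y s) := by
      linear_combination -(1 + β * Y s) * e3 - e4
    rw [← e5]
    linear_combination -4 * (1 + β * Y s) ^ 2 * e2
  have := congrArg (eval x) hpoly
  simpa only [eval_add, eval_mul, eval_C, eval_X, eval_pow, eval_one, eval_ofNat] using this

/-! ### Assembling the equivalence -/

theorem hasDerivAt_potential {I : Set ℝ} (hIo : IsOpen I) (hI : I.OrdConnected)
    (hI0 : (0 : ℝ) ∈ I) {g : ℝ → ℝ} (hg : ContinuousOn g I) {x : ℝ} (hx : x ∈ I) :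
    HasDerivAt (potential g) (g x) x :=
  intervalIntegral.integral_hasDerivAt_right
    ((hg.mono (hI.uIcc_subset hI0 hx)).intervalIntegrable)
    (hg.stronglyMeasurableAtFilter hIo x hx) (hg.continuousAt (hIo.mem_nhds hx))

/-- An isochronous rational potential is isotonic or harmonic. -/
theorem IsIsochronous.exists_isotonic {I : Set ℝ} (hIo : IsOpen I) (hI : I.OrdConnected)
    (hI0 : (0 : ℝ) ∈ I) {g : ℝ → ℝ} (hg : AnalyticOnNhd ℝ g I) (hg0 : g 0 = 0)
    (hg1 : deriv g 0 = 1) (hrat : IsRationalOn (potential g) I) (hiso : IsIsochronous I g) :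
    ∃ β : ℝ, ∀ x ∈ I, 1 + β * x ≠ 0 ∧
      potential g x = (x * (2 + β * x)) ^ 2 / (8 * (1 + β * x) ^ 2) := by
  obtain ⟨P, Q, hPQ⟩ := hrat
  have hder : ∀ x ∈ I, HasDerivAt (potential g) (g x) x := fun x hx =>
    hasDerivAt_potential hIo hI hI0 hg.continuousOn hx
  have hG0 : potential g 0 = 0 := intervalIntegral.integral_same
  have hGan : AnalyticAt ℝ (potential g) 0 := by
    have h1 : AnalyticAt ℝ (fun x => P.eval x / Q.eval x) 0 :=
      ((AnalyticOnNhd.eval_polynomial P) 0 trivial).div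
        ((AnalyticOnNhd.eval_polynomial Q) 0 trivial) (hPQ 0 hI0).1
    refine h1.congr ?_
    filter_upwards [hIo.mem_nhds hI0] with x hx using (hPQ x hx).2.symm
  have hdG : deriv (potential g) =ᶠ[𝓝 0] g := by
    filter_upwards [hIo.mem_nhds hI0] with x hx using (hder x hx).deriv
  obtain ⟨Y, hYan, hY0, hY1, hGY⟩ := hGan.exists_square_coordinate hG0
    (hdG.self_of_nhds.trans hg0) (hdG.deriv_eq.trans hg1)
  have hrefl := hiso.sub_eq_two_mul hIo hI hg hder hG0 hI0 hYan hY0 hY1 hGY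
  have hYs : HasStrictDerivAt Y 1 0 := hY1 ▸ hYan.hasStrictDerivAt
  obtain ⟨β, hβ⟩ := Polynomial.exists_isotonic_identity (P := P) (Q := Q) (hPQ 0 hI0).1 hY0 hYs (by
    filter_upwards [hGY, hYan.continuousAt.eventually (hIo.mem_nhds (hY0.symm ▸ hI0))] with s h1 h2
    obtain ⟨h3, h4⟩ := hPQ _ h2
    rw [h4, div_eq_div_iff h3 two_ne_zero] at h1
    linarith) hrefl
  refine ⟨β, fun x hx => ?_⟩
  obtain ⟨hQ, hG⟩ := hPQ x hx
  have h := hβ x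
  -- At a zero of `1 + βx` the polynomial identity reduces to `Q(x) x² = 0`, so `x = 0`, where `1 +
  -- βx = 1`.
  have hne : 1 + β * x ≠ 0 := by
    intro h0
    have h2 : 2 + β * x = 1 := by linarith
    rw [h0, h2] at h
    have hx0 : x = 0 := by simpa [hQ] using h
    simp [hx0] at h0
  refine ⟨hne, ?_⟩
  rw [hG, div_eq_div_iff hQ (by positivity)]
  linear_combination h

theorem mainTheorem6 (I : Set ℝ) (hIopen : IsOpen I) (hIconn : I.OrdConnected)
    (hI0 : (0 : ℝ) ∈ I) (g : ℝ → ℝ) (hg : AnalyticOnNhd ℝ g I) (hH : HypothesisH I g)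
    (hg0 : g 0 = 0) (hg1 : deriv g 0 = 1)
    (hrat : IsRationalOn (potential g) I) (hnotpoly : ¬ IsPolynomialOn (potential g) I) :
    IsIsochronous I g ↔
      ∃ α : ℝ, α ≠ 0 ∧ ∀ x ∈ I, α * x + 1 ≠ 0 ∧
        potential g x = 1 / (8 * α ^ 2) * (α * x + 1 - 1 / (α * x + 1)) ^ 2 := by
  constructor
  · intro hiso
    obtain ⟨α, hα⟩ := hiso.exists_isotonic hIopen hIconn hI0 hg hg0 hg1 hrat
    -- The value `0` would give the harmonic potential `x²/2`, a polynomial.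
    have hα0 : α ≠ 0 := by
      rintro rfl
      refine hnotpoly ⟨Polynomial.C (1 / 2) * Polynomial.X ^ 2, fun x hx => ?_⟩
      rw [(hα x hx).2]
      simp only [Polynomial.eval_mul, Polynomial.eval_C, Polynomial.eval_pow, Polynomial.eval_X]
      ring
    refine ⟨α, hα0, fun x hx => ?_⟩
    obtain ⟨h1, h2⟩ := hα x hx
    have h3 : α * x + 1 ≠ 0 := by rwa [add_comm]
    refine ⟨h3, ?_⟩
    rw [h2, add_comm 1 (α * x)]
    field_simp
    ring
  · rintro ⟨α, hα, h⟩
    exact IsIsochronous.of_isotonic hIopen hIconn hI0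
      (fun x hx => hasDerivAt_potential hIopen hIconn hI0 hg.continuousOn hx) hα h
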